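/- Fix $q>0$. For $n\ge 1$ let $K_n$ be the complete graph on $n$ vertices with edge set $E_n$. For $\lambda>0$ and a set $A$ of edge configurations $\omega\in\{0,1\}^{E_n}$, put $$Z_{n,\lambda,q}[A]=\sum_{\omega\in A}\Big\{\prod_{e\in E_n}\big(\tfrac{\lambda}{n}\big)^{\omega_e}\big(1-\tfrac{\lambda}{n}\big)^{1-\omega_e}\Big\}q^{k(\omega)},$$ where $k(\omega)$ is the number of connected components of the graph $K_n(\omega)$ formed by all $n$ vertices and the edges $e$ with $\omega_e=1$. (Only $n\ge\lambda$ matters below; for such $n$, $Z_{n,\lambda,q}[A]$ is the probability of $A$ in the random cluster model on $K_n$ with edge weight $\lambda/n$ and cluster weight $q$, multiplied by the partition function.) Let $L$ be the event that $K_n(\omega)$ is acyclic and, for real $r$, let $B_r$ be the event that $K_n(\omega)$ has no connected component with more than $r$ vertices. Theorem. For every $\lambda>0$ the limit $\ell(\lambda)=\lim_{n\to\infty}\frac1n\log Z_{n,\lambda,q}[L]$ exists in $\mathbb R$, and $$\lim_{r\to\infty}\liminf_{n\to\infty}\frac1n\log Z_{n,\lambda,q}[B_r]=\lim_{r\to\infty}\limsup_{n\to\infty}\frac1n\log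 Z_{n,\lambda,q}[B_r]=\ell(\lambda),$$ $$\lim_{\epsilon\downarrow0}\liminf_{n\to\infty}\frac1n\log Z_{n,\lambda,q}[B_{\epsilon n}]=\lim_{\epsilon\downarrow0}\limsup_{n\to\infty}\frac1n\log Z_{n,\lambda,q}[B_{\epsilon n}]=\ell(\lambda).$$ Moreover, the convergence is uniform for $\lambda$ in compact subsets $C$ of $(0,\infty)\setminus\{q\}$, in the following sense. The convergence $\frac1n\log Z_{n,\lambda,q}[L]\to\ell(\lambda)$ as $n\to\infty$ is uniform in $\lambda\in C$; the four limits as $r\to\infty$, respectively $\epsilon\downarrow 0$, displayed above are uniform in $\lambda\in C$; and for every $\delta>0$ there is $r_0$ such that for every $r\ge r_0$ there is $N$ with $$\Big|\frac1n\log Z_{n,\lambda,q}[B_r]-\ell(\lambda)\Big|<\delta\qquad\text{for all } n\ge N,\ \lambda\in C,$$ and there is $\epsilon_0>0$ such that for every $\epsilon\in(0,\epsilon_0)$ there is $N$ with $$\Big|\frac1n\log Z_{n,\lambda,q}[B_{\epsilon n}]-\ell(\lambda)\Big|<\delta\qquad\text{for all } n\ge N,\ \lambda\in C.$$ -/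

import Mathlib

open Filter Topology

noncomputable section

/-- Weight of the configuration `ω` of the random cluster model on the complete graph with vertex
set `Fin n`, with edge weight `p` and cluster weight `q`. A configuration is identified with
its graph of open edges; every simple graph on `Fin n` occurs. -/
def rcWeight (n : ℕ) (p q : ℝ) (ω : SimpleGraph (Fin n)) : ℝ :=
  open Classical in
  (∏ e ∈ (⊤ : SimpleGraph (Fin n)).edgeFinset, if e ∈ ω.edgeSet then p else 1 - p) *
    q ^ Nat.card ω.ConnectedComponent

/-- The partition function restricted to the event `A` (the measure of `A` before
normalisation), for edge weight `lam / n`. -/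
def rcZOn (n : ℕ) (lam q : ℝ) (A : Set (SimpleGraph (Fin n))) : ℝ :=
  open Classical in
  ∑ ω : SimpleGraph (Fin n), if ω ∈ A then rcWeight n (lam / n) q ω else 0

/-- The partition function. -/
def rcZ (n : ℕ) (lam q : ℝ) : ℝ :=
  open Classical in
  ∑ ω : SimpleGraph (Fin n), rcWeight n (lam / n) q ω

/-- The random cluster probability of the event `A`. -/
def rcProb (n : ℕ) (lam q : ℝ) (A : Set (SimpleGraph (Fin n))) : ℝ :=
  open Classical in
  ∑ ω : SimpleGraph (Fin n), if ω ∈ A then rcWeight n (lam / n) q ω / rcZ n lam q else 0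

/-- The partition function is positive as soon as `lam / n` is a probability. -/
theorem rcZ_pos {n : ℕ} {lam q : ℝ} (hq : 0 < q) (h0 : 0 ≤ lam / n) (h1 : lam / n ≤ 1) :
    0 < rcZ n lam q := by
  classical
  have hf : ∀ (ω : SimpleGraph (Fin n)), ∀ e ∈ (⊤ : SimpleGraph (Fin n)).edgeFinset,
      0 ≤ if e ∈ ω.edgeSet then lam / n else 1 - lam / n := by
    intro ω e _
    split_ifs <;> linarith
  have hw : ∀ ω : SimpleGraph (Fin n), 0 ≤ rcWeight n (lam / n) q ω := fun ω =>
    mul_nonneg (Finset.prod_nonneg fun e he => by convert hf ω e he) (pow_nonneg hq.le _)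
  rcases h1.lt_or_eq with h | h
  · refine Finset.sum_pos' (fun ω _ => hw ω) ⟨⊥, Finset.mem_univ _, ?_⟩
    refine mul_pos (Finset.prod_pos fun e _ => ?_) (pow_pos hq _)
    simpa using h
  · refine Finset.sum_pos' (fun ω _ => hw ω) ⟨⊤, Finset.mem_univ _, ?_⟩
    refine mul_pos (Finset.prod_pos fun e he => ?_) (pow_pos hq _)
    rw [SimpleGraph.mem_edgeFinset] at he
    simp only [he, if_true]
    linarith

/-- The restricted partition function is the partition function times the probability. -/
theorem rcZOn_eq {n : ℕ} {lam q : ℝ} (hq : 0 < q) (h0 : 0 ≤ lam / n) (h1 : lam / n ≤ 1)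
    (A : Set (SimpleGraph (Fin n))) : rcZOn n lam q A = rcZ n lam q * rcProb n lam q A := by
  classical
  have hZ := (rcZ_pos hq h0 h1).ne'
  unfold rcZOn rcProb
  rw [Finset.mul_sum]
  refine Finset.sum_congr rfl fun ω _ => ?_
  split_ifs
  · field_simp
  · simp

/-- The event that no connected component has more than `r` vertices. -/
def smallComponents (n : ℕ) (r : ℝ) : Set (SimpleGraph (Fin n)) :=
  {ω | ∀ c : ω.ConnectedComponent, (c.supp.ncard : ℝ) ≤ r}

/-- The event that the graph is acyclic. -/
def acyclicGraphs (n : ℕ) : Set (SimpleGraph (Fin n)) :=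
  {ω | ω.IsAcyclic}

/-- `(1 / n) log Z[A]`. -/
def logRate (lam q : ℝ) (n : ℕ) (A : Set (SimpleGraph (Fin n))) : ℝ :=
  (1 / (n : ℝ)) * Real.log (rcZOn n lam q A)

/-- Lower exponential rate of a sequence of events, in the extended reals. -/
def lowerRate (lam q : ℝ) (A : (n : ℕ) → Set (SimpleGraph (Fin n))) : EReal :=
  liminf (fun n : ℕ => ((logRate lam q n (A n) : ℝ) : EReal)) atTop

/-- Upper exponential rate of a sequence of events, in the extended reals. -/
def upperRate (lam q : ℝ) (A : (n : ℕ) → Set (SimpleGraph (Fin n))) : EReal :=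
  limsup (fun n : ℕ => ((logRate lam q n (A n) : ℝ) : EReal)) atTop

/-- Uniform convergence on `K` of extended-real-valued functions to a real-valued function. -/
def ERealTendstoUniformlyOn {ι : Type*} (F : ι → ℝ → EReal) (f : ℝ → ℝ) (p : Filter ι)
    (K : Set ℝ) : Prop :=
  ∀ δ : ℝ, 0 < δ → ∀ᶠ i in p, ∀ x ∈ K,
    ((f x - δ : ℝ) : EReal) < F i x ∧ F i x < ((f x + δ : ℝ) : EReal)

end

noncomputable section

/-! Put `p = λ/n`. A forest with `k` components has `n - k` edges, so its weight is `p ^ n (1 - p) ^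
(n choose 2) (q/p) ^ k`, up to a factor between `1` and `(1 - p) ^ (-n) = O(1)`. Everything reduces
to the growth of `compSum`, the sum of `x ^ k` over forests, at `x = q/p = (q/λ) n`.

For a family closed under disjoint unions, splitting the components of a graph into two classes and
expanding `(x + y) ^ k` gives `compSum_mul_le`. With `x = tm`, `y = tn` this makes `compSum A n (tn)
/ n!` supermultiplicative, and Fekete's lemma yields the limit; finiteness comes from `q = 1`, where
the total mass is at most `1`.

Lower bound for bounded components: Fekete also applies to forests with components of size at most
`r`. At `n = r` these are all the forests, so their rate is at least the value of the forest rate at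
`r`, which tends to its limit (`exists_lt_componentRate_smallForests`).

Upper bound: a graph in `B_r` lies between a spanning forest `F` and the graph completing every
component of `F`, which has at most `nr` edges. Hence `Z[B_r] ≤ (1 - p) ^ (-nr) Z[L]`
(`rcZOn_smallComponents_le`), a cost in the rate of order `r/n` for fixed `r` and of order `ε` for
`r = εn`.

Uniformity: all component rates are 1-Lipschitz in `log t`, whatever `n` and the family. -/

/-! ### Forests and disjoint sums of graphs. -/

theorem SimpleGraph.degree_toSimpleGraph {V : Type*} [Fintype V] (G : SimpleGraph V)
    [DecidableRel G.Adj] (c : G.ConnectedComponent) [Fintype c] [DecidableRel c.toSimpleGraph.Adj]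
    (v : c) : c.toSimpleGraph.degree v = G.degree v := by
  classical
  rw [← SimpleGraph.card_neighborFinset_eq_degree, ← SimpleGraph.card_neighborFinset_eq_degree]
  refine Finset.card_bij (fun w _ => (w : V)) ?_ (fun _ _ _ _ h => Subtype.ext h) ?_
  · intro w hw
    rw [SimpleGraph.mem_neighborFinset] at hw ⊢
    exact hw
  · intro w hw
    rw [SimpleGraph.mem_neighborFinset] at hw
    exact ⟨⟨w, c.mem_supp_of_adj_mem_supp v.2 hw⟩, (SimpleGraph.mem_neighborFinset _ _ _).2 hw, rfl⟩

/-- A forest has as many vertices as edges and components together. -/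
theorem SimpleGraph.IsAcyclic.ncard_edgeSet_add_card {V : Type*} [Finite V] {G : SimpleGraph V}
    (hG : G.IsAcyclic) : G.edgeSet.ncard + Nat.card G.ConnectedComponent = Nat.card V := by
  classical
  have := Fintype.ofFinite V
  -- Each component is a tree; its edge count is doubled and written as a degree sum so that summing
  -- over components gives the handshake formula for `G`.
  have hc : ∀ c : G.ConnectedComponent,
      ∑ v ∈ Finset.univ.filter (fun v => G.connectedComponentMk v = c), G.degree v + 2
        = 2 * (Finset.univ.filter (fun v => G.connectedComponentMk v = c)).card := by
    intro c
    have ht := (hG.isTree_connectedComponent c).card_edgeFinset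
    have hs := c.toSimpleGraph.sum_degrees_eq_twice_card_edges
    have e1 : ∑ v : c, c.toSimpleGraph.degree v =
        ∑ v ∈ Finset.univ.filter (fun v => G.connectedComponentMk v = c), G.degree v := by
      simp_rw [SimpleGraph.degree_toSimpleGraph]
      exact (Finset.sum_subtype _ (fun v => by simp; rfl) (fun v => G.degree v)).symm
    have e2 : Fintype.card c =
        (Finset.univ.filter (fun v => G.connectedComponentMk v = c)).card :=
      Fintype.card_of_subtype _ (fun v => by simp; rfl)
    rw [e1] at hs
    rw [e2] at ht
    omega
  have h1 := Finset.sum_congr rfl fun c (_ : c ∈ (Finset.univ : Finset G.ConnectedComponent)) => hc c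
  have h3 : ∑ c : G.ConnectedComponent,
      ∑ v ∈ Finset.univ.filter (fun v => G.connectedComponentMk v = c), G.degree v
        = ∑ v, G.degree v :=
    Finset.sum_fiberwise_of_maps_to (fun v _ => Finset.mem_univ _) _
  rw [Finset.sum_add_distrib, ← Finset.mul_sum, h3,
    G.sum_degrees_eq_twice_card_edges] at h1
  have h2 : ∑ c : G.ConnectedComponent,
      (Finset.univ.filter (fun v => G.connectedComponentMk v = c)).card = Fintype.card V :=
    (Finset.card_eq_sum_card_fiberwise (fun v _ => Finset.mem_univ _)).symm
  rw [h2] at h1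
  simp only [Finset.sum_const, Finset.card_univ, smul_eq_mul] at h1
  rw [← SimpleGraph.coe_edgeFinset, Set.ncard_coe_finset, Nat.card_eq_fintype_card,
    Nat.card_eq_fintype_card]
  omega

theorem SimpleGraph.reachable_sum_inl {V W : Type*} {G : SimpleGraph V} {H : SimpleGraph W}
    {u v : V} : (G ⊕g H).Reachable (.inl u) (.inl v) ↔ G.Reachable u v := by
  refine ⟨fun h => ?_, fun h => h.map SimpleGraph.Embedding.sumInl.toHom⟩
  rw [SimpleGraph.reachable_iff_reflTransGen] at h
  have : ∀ x, Relation.ReflTransGen (G ⊕g H).Adj (.inl u) x → ∃ w, x = .inl w ∧ G.Reachable u w := by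
    intro x hx
    induction hx with
    | refl => exact ⟨u, rfl, .rfl⟩
    | @tail b c _ hbc ih =>
      obtain ⟨w, rfl, hw⟩ := ih
      rcases c with c | c
      · exact ⟨c, rfl, hw.trans (SimpleGraph.sum_adj_inl.1 hbc).reachable⟩
      · simp at hbc
  obtain ⟨w, hw, hr⟩ := this _ h
  cases hw
  exact hr

theorem SimpleGraph.reachable_sum_inr {V W : Type*} {G : SimpleGraph V} {H : SimpleGraph W}
    {u v : W} : (G ⊕g H).Reachable (.inr u) (.inr v) ↔ H.Reachable u v := by
  rw [← SimpleGraph.reachable_sum_inl (G := H) (H := G),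
    ← (SimpleGraph.Iso.sumComm (G := G) (H := H)).reachable_iff]
  rfl

/-- The components of a disjoint sum. -/
def SimpleGraph.connectedComponentSumEquiv {V W : Type*} (G : SimpleGraph V) (H : SimpleGraph W) :
    G.ConnectedComponent ⊕ H.ConnectedComponent ≃ (G ⊕g H).ConnectedComponent :=
  Equiv.ofBijective
    (Sum.elim (SimpleGraph.ConnectedComponent.map SimpleGraph.Embedding.sumInl.toHom)
      (SimpleGraph.ConnectedComponent.map SimpleGraph.Embedding.sumInr.toHom)) (by
    constructor
    · rintro (c | c) (d | d) h
      · induction c, d using SimpleGraph.ConnectedComponent.ind₂ with | _ v w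
        exact congrArg _ (SimpleGraph.ConnectedComponent.sound
          (SimpleGraph.reachable_sum_inl.1 (SimpleGraph.ConnectedComponent.exact h)))
      · induction c using SimpleGraph.ConnectedComponent.ind with | _ v
        induction d using SimpleGraph.ConnectedComponent.ind with | _ w
        exact (SimpleGraph.not_reachable_sum_inl_inr _ _
          (SimpleGraph.ConnectedComponent.exact h)).elim
      · induction c using SimpleGraph.ConnectedComponent.ind with | _ v
        induction d using SimpleGraph.ConnectedComponent.ind with | _ w
        exact (SimpleGraph.not_reachable_sum_inl_inr _ _
          (SimpleGraph.ConnectedComponent.exact h).symm).elim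
      · induction c, d using SimpleGraph.ConnectedComponent.ind₂ with | _ v w
        exact congrArg _ (SimpleGraph.ConnectedComponent.sound
          (SimpleGraph.reachable_sum_inr.1 (SimpleGraph.ConnectedComponent.exact h)))
    · intro c
      induction c using SimpleGraph.ConnectedComponent.ind with | _ v
      rcases v with v | v
      · exact ⟨.inl (G.connectedComponentMk v), rfl⟩
      · exact ⟨.inr (H.connectedComponentMk v), rfl⟩)

/-- Acyclic means that every edge is a bridge, and deleting an edge of one summand leaves a disjoint
sum. -/
theorem SimpleGraph.IsAcyclic.sum {V W : Type*} {G : SimpleGraph V} {H : SimpleGraph W}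
    (hG : G.IsAcyclic) (hH : H.IsAcyclic) : (G ⊕g H).IsAcyclic := by
  rw [SimpleGraph.isAcyclic_iff_forall_adj_isBridge] at *
  have hl : ∀ u v, (G ⊕g H).deleteEdges {s(.inl u, .inl v)} = G.deleteEdges {s(u, v)} ⊕g H := by
    intro u v
    ext (a | a) (b | b) <;> simp
  have hr : ∀ u v, (G ⊕g H).deleteEdges {s(.inr u, .inr v)} = G ⊕g H.deleteEdges {s(u, v)} := by
    intro u v
    ext (a | a) (b | b) <;> simp
  rintro (u | u) (v | v) h
  · have := hG (SimpleGraph.sum_adj_inl.1 h)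
    rw [SimpleGraph.isBridge_iff] at this ⊢
    rwa [hl, SimpleGraph.reachable_sum_inl]
  · simp at h
  · simp at h
  · have := hH (SimpleGraph.sum_adj_inr.1 h)
    rw [SimpleGraph.isBridge_iff] at this ⊢
    rwa [hr, SimpleGraph.reachable_sum_inr]

/-- Written through reachability, the event transfers at once to relabelled graphs and to spanning
forests. -/
theorem smallComponents_iff {n : ℕ} {r : ℝ} {G : SimpleGraph (Fin n)} :
    G ∈ smallComponents n r ↔ ∀ v, (({w | G.Reachable v w} : Set (Fin n)).ncard : ℝ) ≤ r := by
  have : ∀ v, (G.connectedComponentMk v).supp = {w | G.Reachable v w} := by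
    intro v
    ext w
    rw [SimpleGraph.ConnectedComponent.mem_supp_iff, SimpleGraph.ConnectedComponent.eq,
      SimpleGraph.reachable_comm]
    rfl
  unfold smallComponents
  rw [Set.mem_ofPred_eq, SimpleGraph.ConnectedComponent.forall]
  simp_rw [this]

/-! ### Supermultiplicativity for families closed under disjoint sums. -/

/-- A family of sets of graphs closed under disjoint sums. -/
def SumClosed (A : (n : ℕ) → Set (SimpleGraph (Fin n))) : Prop :=
  ∀ m n, ∀ F ∈ A m, ∀ H ∈ A n, ∀ e : Fin m ⊕ Fin n ≃ Fin (m + n),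
    (F ⊕g H).map e ∈ A (m + n)

theorem sumClosed_acyclicGraphs : SumClosed acyclicGraphs := by
  intro m n F hF H hH e
  exact (SimpleGraph.Iso.isAcyclic_iff (SimpleGraph.Iso.map e (F ⊕g H))).1
    (SimpleGraph.IsAcyclic.sum hF hH)

theorem sumClosed_smallComponents (r : ℝ) : SumClosed fun n => smallComponents n r := by
  intro m n F hF H hH e
  simp only [smallComponents_iff] at *
  have key : ∀ u w, ((F ⊕g H).map e).Reachable (e u) (e w) ↔ (F ⊕g H).Reachable u w :=
    fun u w => SimpleGraph.Iso.reachable_iff (φ := SimpleGraph.Iso.map e (F ⊕g H))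
  intro v
  obtain ⟨u, rfl⟩ := e.surjective v
  rcases u with u | u
  · refine le_trans (Nat.cast_le.2 ?_) (hF u)
    rw [← Set.ncard_image_of_injective _
      (e.injective.comp (Sum.inl_injective : Function.Injective (Sum.inl : Fin m → Fin m ⊕ Fin n)))]
    refine Set.ncard_le_ncard (fun w hw => ?_) (Set.toFinite _)
    obtain ⟨w, rfl⟩ := e.surjective w
    rcases w with w | w
    · exact ⟨w, SimpleGraph.reachable_sum_inl.1 ((key _ _).1 hw), rfl⟩
    · exact (SimpleGraph.not_reachable_sum_inl_inr _ _ ((key _ _).1 hw)).elim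
  · refine le_trans (Nat.cast_le.2 ?_) (hH u)
    rw [← Set.ncard_image_of_injective _
      (e.injective.comp (Sum.inr_injective : Function.Injective (Sum.inr : Fin n → Fin m ⊕ Fin n)))]
    refine Set.ncard_le_ncard (fun w hw => ?_) (Set.toFinite _)
    obtain ⟨w, rfl⟩ := e.surjective w
    rcases w with w | w
    · exact (SimpleGraph.not_reachable_sum_inl_inr _ _ ((key _ _).1 hw).symm).elim
    · exact ⟨w, SimpleGraph.reachable_sum_inr.1 ((key _ _).1 hw), rfl⟩

theorem SumClosed.inter {A B : (n : ℕ) → Set (SimpleGraph (Fin n))} (hA : SumClosed A)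
    (hB : SumClosed B) : SumClosed fun n => A n ∩ B n :=
  fun m n F hF H hH e => ⟨hA m n F hF.1 H hH.1 e, hB m n F hF.2 H hH.2 e⟩

open Classical in
/-- The generating function of the number of components over the graphs of a family. -/
def compSum (A : (n : ℕ) → Set (SimpleGraph (Fin n))) (n : ℕ) (t : ℝ) : ℝ :=
  ∑ F : SimpleGraph (Fin n) with F ∈ A n, t ^ Nat.card F.ConnectedComponent

open Classical in
-- Expand the right side over subsets of the set of components. A closed vertex set is a union of
-- components, so it is determined by the subset it contributes.
theorem sum_closed_le_add_pow {V : Type*} [Fintype V] (F : SimpleGraph V)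
    (T : Finset (Finset V)) (hT : ∀ S ∈ T, ∀ u v, F.Reachable u v → u ∈ S → v ∈ S)
    {x y : ℝ} (hx : 0 ≤ x) (hy : 0 ≤ y) :
    ∑ S ∈ T, x ^ (S.image F.connectedComponentMk).card *
        y ^ (Nat.card F.ConnectedComponent - (S.image F.connectedComponentMk).card)
      ≤ (x + y) ^ Nat.card F.ConnectedComponent := by
  rw [Nat.card_eq_fintype_card, ← Fintype.sum_pow_mul_eq_add_pow]
  have hinj : Set.InjOn (fun S : Finset V => S.image F.connectedComponentMk) T := by
    have hsub : ∀ S ∈ T, ∀ S' ∈ T, S.image F.connectedComponentMk = S'.image F.connectedComponentMk →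
        S ⊆ S' := by
      intro S _ S' hS' h v hv
      have : F.connectedComponentMk v ∈ S'.image F.connectedComponentMk :=
        h ▸ Finset.mem_image_of_mem _ hv
      obtain ⟨u, hu, huv⟩ := Finset.mem_image.1 this
      exact hT S' hS' u v (SimpleGraph.ConnectedComponent.exact huv) hu
    exact fun S hS S' hS' h => (hsub S hS S' hS' h).antisymm (hsub S' hS' S hS h.symm)
  rw [← Finset.sum_image (f := fun s : Finset F.ConnectedComponent =>
    x ^ s.card * y ^ (Fintype.card F.ConnectedComponent - s.card)) hinj]
  exact Finset.sum_le_sum_of_subset_of_nonneg (Finset.subset_univ _) fun _ _ _ => by positivity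

theorem card_connectedComponent_map_sum {V W U : Type*} [Finite V] [Finite W]
    (F : SimpleGraph V) (H : SimpleGraph W) (e : V ⊕ W ≃ U) :
    Nat.card ((F ⊕g H).map e).ConnectedComponent
      = Nat.card F.ConnectedComponent + Nat.card H.ConnectedComponent := by
  rw [← Nat.card_congr (SimpleGraph.Iso.map e (F ⊕g H)).connectedComponentEquiv,
    ← Nat.card_congr (SimpleGraph.connectedComponentSumEquiv F H), Nat.card_sum]

theorem reachable_map_equiv {V U : Type*} (G : SimpleGraph V) (e : V ≃ U) (u v : V) :
    (G.map e).Reachable (e u) (e v) ↔ G.Reachable u v :=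
  SimpleGraph.Iso.reachable_iff (φ := SimpleGraph.Iso.map e G)

open Classical in
theorem card_image_connectedComponentMk_map_sum {V W U : Type*} [Fintype V]
    (F : SimpleGraph V) (H : SimpleGraph W) (e : V ⊕ W ≃ U) (S : Finset U)
    (hl : ∀ v, e (.inl v) ∈ S) (hr : ∀ w, e (.inr w) ∉ S) :
    (S.image ((F ⊕g H).map e).connectedComponentMk).card
      = Nat.card F.ConnectedComponent := by
  let φ : F →g (F ⊕g H).map e :=
    (SimpleGraph.Iso.map e (F ⊕g H)).toHom.comp SimpleGraph.Embedding.sumInl.toHom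
  have hφ : Function.Injective (SimpleGraph.ConnectedComponent.map φ) := by
    intro c d h
    induction c, d using SimpleGraph.ConnectedComponent.ind₂ with | _ v w
    exact SimpleGraph.ConnectedComponent.sound (SimpleGraph.reachable_sum_inl.1
      ((reachable_map_equiv _ e _ _).1 (SimpleGraph.ConnectedComponent.exact h)))
  have : S.image ((F ⊕g H).map e).connectedComponentMk
      = Finset.univ.image (SimpleGraph.ConnectedComponent.map φ) := by
    ext c
    simp only [Finset.mem_image, Finset.mem_univ, true_and]
    constructor
    · rintro ⟨u, hu, rfl⟩
      obtain ⟨u, rfl⟩ := e.surjective u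
      rcases u with u | u
      · exact ⟨F.connectedComponentMk u, rfl⟩
      · exact (hr u hu).elim
    · rintro ⟨d, rfl⟩
      induction d using SimpleGraph.ConnectedComponent.ind with | _ v
      exact ⟨e (.inl v), hl v, rfl⟩
  rw [this, Finset.card_image_of_injective _ hφ, Finset.card_univ, Nat.card_eq_fintype_card]

theorem sum_comp_le_sum {ι κ : Type*} {g : ι → κ} (hg : Function.Injective g) {s : Finset ι}
    {t : Finset κ} (hst : ∀ i ∈ s, g i ∈ t) {Φ : κ → ℝ} (hΦ : ∀ k, 0 ≤ Φ k) :
    ∑ i ∈ s, Φ (g i) ≤ ∑ k ∈ t, Φ k := by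
  classical
  rw [← Finset.sum_image hg.injOn]
  refine Finset.sum_le_sum_of_subset_of_nonneg (fun k hk => ?_) fun k _ _ => hΦ k
  obtain ⟨i, hi, rfl⟩ := Finset.mem_image.1 hk
  exact hst i hi

open Classical in
-- Double counting of pairs of a graph and a closed vertex set `S` of size `m`. For fixed `S`, pairs
-- of graphs on `S` and its complement embed by disjoint union; for fixed graph, the sum over `S` is
-- at most `(x + y) ^ k`.
theorem compSum_mul_le {A : (n : ℕ) → Set (SimpleGraph (Fin n))} (hA : SumClosed A) (m n : ℕ)
    {x y : ℝ} (hx : 0 ≤ x) (hy : 0 ≤ y) :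
    ((m + n).choose m : ℝ) * (compSum A m x * compSum A n y) ≤ compSum A (m + n) (x + y) := by
  let closed (F : SimpleGraph (Fin (m + n))) (S : Finset (Fin (m + n))) : Prop :=
    ∀ u v, F.Reachable u v → u ∈ S → v ∈ S
  let f (F : SimpleGraph (Fin (m + n))) (S : Finset (Fin (m + n))) : ℝ :=
    x ^ (S.image F.connectedComponentMk).card *
        y ^ (Nat.card F.ConnectedComponent - (S.image F.connectedComponentMk).card)
  have hf : ∀ F S, 0 ≤ f F S := fun F S => by positivity
  have hS : ∀ S ∈ Finset.powersetCard m (Finset.univ : Finset (Fin (m + n))),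
      compSum A m x * compSum A n y
        ≤ ∑ F : SimpleGraph (Fin (m + n)) with F ∈ A (m + n) ∧ closed F S, f F S := by
    intro S hS
    have hc := (Finset.mem_powersetCard.1 hS).2
    have hc' : Sᶜ.card = n := by rw [Finset.card_compl, hc, Fintype.card_fin]; omega
    let e := finSumEquivOfFinset hc hc'
    have hl : ∀ v, e (.inl v) ∈ S := fun v => by
      simp only [e, finSumEquivOfFinset_inl]; exact Finset.orderEmbOfFin_mem _ _ _
    have hr : ∀ v, e (.inr v) ∉ S := fun v => by
      rw [← Finset.mem_compl]
      simp only [e, finSumEquivOfFinset_inr]; exact Finset.orderEmbOfFin_mem _ _ _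
    let g : SimpleGraph (Fin m) × SimpleGraph (Fin n) → SimpleGraph (Fin (m + n)) :=
      fun P => (P.1 ⊕g P.2).map e
    have hg : Function.Injective g := by
      rintro ⟨F, H⟩ ⟨F', H'⟩ h
      have h' := SimpleGraph.map_injective e.toEmbedding h
      refine Prod.ext ?_ ?_
      · ext u v
        simpa using congrArg (fun G => G.Adj (.inl u) (.inl v)) h'
      · ext u v
        simpa using congrArg (fun G => G.Adj (.inr u) (.inr v)) h'
    have hcl : ∀ P, closed (g P) S := by
      intro P u v huv hu
      obtain ⟨u, rfl⟩ := e.surjective u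
      obtain ⟨v, rfl⟩ := e.surjective v
      have := (reachable_map_equiv _ e _ _).1 huv
      rcases u with u | u
      · rcases v with v | v
        · exact hl v
        · exact (SimpleGraph.not_reachable_sum_inl_inr _ _ this).elim
      · exact (hr u hu).elim
    have hΦ : ∀ P, f (g P) S
        = x ^ Nat.card P.1.ConnectedComponent * y ^ Nat.card P.2.ConnectedComponent := by
      intro P
      simp only [f, g]
      rw [card_image_connectedComponentMk_map_sum _ _ e S hl hr,
        card_connectedComponent_map_sum, Nat.add_sub_cancel_left]
    rw [compSum, compSum, Finset.sum_mul_sum, ← Finset.sum_product']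
    simp_rw [← hΦ]
    refine sum_comp_le_sum (g := g) (Φ := fun F => f F S) hg (fun P hP => ?_) fun F => hf F S
    rw [Finset.mem_product, Finset.mem_filter, Finset.mem_filter] at hP
    exact Finset.mem_filter.2 ⟨Finset.mem_univ _, hA m n _ hP.1.2 _ hP.2.2 e, hcl P⟩
  calc ((m + n).choose m : ℝ) * (compSum A m x * compSum A n y)
      = ∑ S ∈ Finset.powersetCard m (Finset.univ : Finset (Fin (m + n))),
          compSum A m x * compSum A n y := by
        rw [Finset.sum_const, Finset.card_powersetCard, Finset.card_univ, Fintype.card_fin,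
          nsmul_eq_mul]
    _ ≤ _ := Finset.sum_le_sum hS
    _ = ∑ F : SimpleGraph (Fin (m + n)) with F ∈ A (m + n),
          ∑ S ∈ (Finset.powersetCard m Finset.univ).filter (closed F), f F S := by
        refine Finset.sum_comm' fun S F => ?_
        simp only [Finset.mem_filter, Finset.mem_univ, true_and]
        tauto
    _ ≤ _ := Finset.sum_le_sum fun F _ =>
        sum_closed_le_add_pow F _ (fun S hS => (Finset.mem_filter.1 hS).2) hx hy

/-! ### Bernoulli weights and the comparison with spanning forests. -/

/-- The Bernoulli weight of a graph. -/
def edgeWeight {n : ℕ} (p : ℝ) (ω : SimpleGraph (Fin n)) : ℝ :=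
  open Classical in
  ∏ e ∈ (⊤ : SimpleGraph (Fin n)).edgeFinset, if e ∈ ω.edgeSet then p else 1 - p

theorem rcWeight_eq_edgeWeight_mul {n : ℕ} (p q : ℝ) (ω : SimpleGraph (Fin n)) :
    rcWeight n p q ω = edgeWeight p ω * q ^ Nat.card ω.ConnectedComponent := rfl

theorem ncard_edgeSet_le {n : ℕ} (G : SimpleGraph (Fin n)) : G.edgeSet.ncard ≤ n.choose 2 := by
  classical
  rw [← SimpleGraph.coe_edgeFinset, Set.ncard_coe_finset]
  simpa using G.card_edgeFinset_le_card_choose_two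

theorem prod_edgeSet_ite {n : ℕ} (ω : SimpleGraph (Fin n)) (a b : ℝ) :
    (open Classical in
      ∏ e ∈ (⊤ : SimpleGraph (Fin n)).edgeFinset, if e ∈ ω.edgeSet then a else b)
      = a ^ ω.edgeSet.ncard * b ^ (n.choose 2 - ω.edgeSet.ncard) := by
  classical
  have h1 : ((⊤ : SimpleGraph (Fin n)).edgeFinset.filter (· ∈ ω.edgeSet)) = ω.edgeFinset := by
    ext e
    simp only [Finset.mem_filter, SimpleGraph.mem_edgeFinset, and_iff_right_iff_imp]
    exact fun h => SimpleGraph.edgeSet_mono le_top h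
  have h2 := Finset.card_filter_add_card_filter_not
    (s := (⊤ : SimpleGraph (Fin n)).edgeFinset) (fun e => e ∈ ω.edgeSet)
  have h3 : (⊤ : SimpleGraph (Fin n)).edgeFinset.card = n.choose 2 := by
    rw [SimpleGraph.card_edgeFinset_top_eq_card_choose_two, Fintype.card_fin]
  have h4 : ω.edgeSet.ncard = ω.edgeFinset.card := by
    rw [← SimpleGraph.coe_edgeFinset, Set.ncard_coe_finset]
  rw [h1, h3] at h2
  have h5 : n.choose 2 - ω.edgeSet.ncard =
    ((⊤ : SimpleGraph (Fin n)).edgeFinset.filter (¬ · ∈ ω.edgeSet)).card := by omega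
  rw [h5, h4, ← h1, ← Finset.prod_const, ← Finset.prod_const, ← Finset.prod_ite]

theorem edgeWeight_eq {n : ℕ} (p : ℝ) (ω : SimpleGraph (Fin n)) :
    edgeWeight p ω = p ^ ω.edgeSet.ncard * (1 - p) ^ (n.choose 2 - ω.edgeSet.ncard) :=
  prod_edgeSet_ite ω p (1 - p)

open Classical in
/-- The total Bernoulli weight of the graphs between `F` and `H`. -/
theorem sum_edgeWeight_le {n : ℕ} {p : ℝ} (h0 : 0 ≤ p) (h1 : p ≤ 1) {F H : SimpleGraph (Fin n)}
    (hFH : F ≤ H) (T : Finset (SimpleGraph (Fin n))) (hT : ∀ ω ∈ T, F ≤ ω ∧ ω ≤ H) :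
    ∑ ω ∈ T, edgeWeight p ω
      ≤ p ^ F.edgeSet.ncard * (1 - p) ^ (n.choose 2 - H.edgeSet.ncard) := by
  set E := (⊤ : SimpleGraph (Fin n)).edgeFinset
  -- In the expansion of `∏ (f + g)` over edge sets, `f` kills those leaving `H` and `g` those
  -- missing an edge of `F`. The factor is `p` on `F`, `1` on the rest of `H`, and `1 - p` off `H`.
  let f : Sym2 (Fin n) → ℝ := fun e => if e ∈ H.edgeSet then p else 0
  let g : Sym2 (Fin n) → ℝ := fun e => if e ∈ F.edgeSet then 0 else 1 - p
  have hf : ∀ e, 0 ≤ f e := fun e => by simp only [f]; split_ifs <;> linarith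
  have hg : ∀ e, 0 ≤ g e := fun e => by simp only [g]; split_ifs <;> linarith
  have hE : ∏ e ∈ E, (f e + g e)
      = p ^ F.edgeSet.ncard * (1 - p) ^ (n.choose 2 - H.edgeSet.ncard) := by
    have hF := prod_edgeSet_ite F p 1
    have hH := prod_edgeSet_ite H 1 (1 - p)
    rw [one_pow, mul_one] at hF
    rw [one_pow, one_mul] at hH
    rw [← hF, ← hH, ← Finset.prod_mul_distrib]
    refine Finset.prod_congr (by congr!) fun e _ => ?_
    have : e ∈ F.edgeSet → e ∈ H.edgeSet := fun h => SimpleGraph.edgeSet_mono hFH h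
    simp only [f, g]
    split_ifs <;> simp_all
  let φ : SimpleGraph (Fin n) → Finset (Sym2 (Fin n)) := fun ω => E.filter (· ∈ ω.edgeSet)
  have hφ : Function.Injective φ := by
    intro ω ω' h
    rw [← SimpleGraph.edgeSet_inj]
    have : ∀ ω : SimpleGraph (Fin n), (φ ω : Set (Sym2 (Fin n))) = ω.edgeSet := by
      intro ω
      ext e
      simp only [φ, Finset.coe_filter, Set.mem_ofPred_eq, E, SimpleGraph.mem_edgeFinset,
        and_iff_right_iff_imp]
      exact fun h => SimpleGraph.edgeSet_mono le_top h
    rw [← this, ← this, h]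
  rw [← hE, Finset.prod_add]
  calc ∑ ω ∈ T, edgeWeight p ω
      = ∑ ω ∈ T, (∏ e ∈ φ ω, f e) * ∏ e ∈ E \ φ ω, g e := by
        refine Finset.sum_congr rfl fun ω hω => ?_
        have hs : E \ φ ω = E.filter (¬ · ∈ ω.edgeSet) := by
          ext e; simp only [φ, Finset.mem_sdiff, Finset.mem_filter]; tauto
        rw [hs]
        have e1 : ∏ e ∈ φ ω, f e = ∏ e ∈ φ ω, p := Finset.prod_congr rfl fun e he => by
          simp only [f]
          rw [if_pos (SimpleGraph.edgeSet_mono (hT ω hω).2 (Finset.mem_filter.1 he).2)]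
        have e2 : ∏ e ∈ E.filter (¬ · ∈ ω.edgeSet), g e
            = ∏ e ∈ E.filter (¬ · ∈ ω.edgeSet), (1 - p) := Finset.prod_congr rfl fun e he => by
          simp only [g]
          rw [if_neg fun h =>
            (Finset.mem_filter.1 he).2 (SimpleGraph.edgeSet_mono (hT ω hω).1 h)]
        rw [e1, e2, ← Finset.prod_ite]
        unfold edgeWeight
        congr!
    _ ≤ _ := by
        refine sum_comp_le_sum hφ (fun ω _ => Finset.mem_powerset.2 (Finset.filter_subset _ _))
          (Φ := fun s => (∏ e ∈ s, f e) * ∏ e ∈ E \ s, g e) fun s =>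
          mul_nonneg (Finset.prod_nonneg fun e _ => hf e) (Finset.prod_nonneg fun e _ => hg e)

open Classical in
theorem rcZOn_eq_sum_filter (n : ℕ) (lam q : ℝ) (A : Set (SimpleGraph (Fin n))) :
    rcZOn n lam q A = ∑ ω : SimpleGraph (Fin n) with ω ∈ A, rcWeight n (lam / n) q ω := by
  rw [Finset.sum_filter]
  rfl

theorem rcWeight_pos {n : ℕ} {p q : ℝ} (hq : 0 < q) (h0 : 0 < p) (h1 : p < 1)
    (ω : SimpleGraph (Fin n)) : 0 < rcWeight n p q ω := by
  have := sub_pos.2 h1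
  rw [rcWeight_eq_edgeWeight_mul, edgeWeight_eq]
  positivity

theorem rcZOn_mono {n : ℕ} {lam q : ℝ} (hq : 0 < q) (h0 : 0 < lam / n) (h1 : lam / n < 1)
    {A B : Set (SimpleGraph (Fin n))} (hAB : A ⊆ B) : rcZOn n lam q A ≤ rcZOn n lam q B := by
  classical
  rw [rcZOn_eq_sum_filter, rcZOn_eq_sum_filter]
  refine Finset.sum_le_sum_of_subset_of_nonneg ?_ fun ω _ _ => (rcWeight_pos hq h0 h1 ω).le
  exact fun ω hω => Finset.mem_filter.2 ⟨Finset.mem_univ _, hAB (Finset.mem_filter.1 hω).2⟩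

theorem rcZOn_pos {n : ℕ} {lam q : ℝ} (hq : 0 < q) (h0 : 0 < lam / n) (h1 : lam / n < 1)
    {A : Set (SimpleGraph (Fin n))} (hA : A.Nonempty) : 0 < rcZOn n lam q A := by
  classical
  rw [rcZOn_eq_sum_filter]
  obtain ⟨ω, hω⟩ := hA
  exact Finset.sum_pos (fun ω _ => rcWeight_pos hq h0 h1 ω)
    ⟨ω, Finset.mem_filter.2 ⟨Finset.mem_univ _, hω⟩⟩

theorem bot_mem_smallComponents {n : ℕ} {r : ℝ} (hr : 1 ≤ r) : ⊥ ∈ smallComponents n r := by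
  rw [smallComponents_iff]
  intro v
  simpa [SimpleGraph.reachable_bot] using hr

/-- The graph joining any two distinct vertices of the same component. -/
def componentClosure {V : Type*} (F : SimpleGraph V) : SimpleGraph V where
  Adj u v := u ≠ v ∧ F.Reachable u v
  symm.symm _ _ h := ⟨h.1.symm, h.2.symm⟩
  loopless.irrefl _ h := h.1 rfl

/-- Degrees are at most component sizes; the factor `1/2` from the handshake formula is given away.
-/
theorem ncard_edgeSet_componentClosure_le {n : ℕ} {r : ℝ} {F : SimpleGraph (Fin n)}
    (hF : F ∈ smallComponents n r) : ((componentClosure F).edgeSet.ncard : ℝ) ≤ n * r := by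
  classical
  rw [smallComponents_iff] at hF
  have h1 := (componentClosure F).sum_degrees_eq_twice_card_edges
  have h2 : (componentClosure F).edgeSet.ncard = (componentClosure F).edgeFinset.card := by
    rw [← SimpleGraph.coe_edgeFinset, Set.ncard_coe_finset]
  have h3 : ((∑ v, (componentClosure F).degree v : ℕ) : ℝ) ≤ n * r := by
    push_cast
    calc _ ≤ ∑ v : Fin n, r := Finset.sum_le_sum fun v _ => ?_
      _ = n * r := by simp
    refine le_trans (Nat.cast_le.2 ?_) (hF v)
    rw [← SimpleGraph.card_neighborFinset_eq_degree, ← Set.ncard_coe_finset]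
    refine Set.ncard_le_ncard (fun w hw => ?_) (Set.toFinite _)
    rw [SimpleGraph.coe_neighborFinset] at hw
    exact hw.2
  rw [h1, ← h2] at h3
  push_cast at h3
  have : (0 : ℝ) ≤ (componentClosure F).edgeSet.ncard := Nat.cast_nonneg _
  linarith

theorem card_connectedComponent_congr {V : Type*} {G H : SimpleGraph V}
    (h : G.Reachable = H.Reachable) :
    Nat.card G.ConnectedComponent = Nat.card H.ConnectedComponent := by
  unfold SimpleGraph.ConnectedComponent
  rw [h]

/-- Passing to spanning forests, a bound on the component sizes costs little. -/
theorem rcZOn_smallComponents_le {n : ℕ} {lam q r : ℝ} (hq : 0 < q) (h0 : 0 < lam / n)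
    (h1 : lam / n < 1) :
    rcZOn n lam q (smallComponents n r) ≤
      (1 - lam / n) ^ (-(n * r)) * rcZOn n lam q (acyclicGraphs n) := by
  classical
  set p := lam / n with hp
  have hs := sub_pos.2 h1
  -- `T ω` is a spanning forest of `ω`; the left sum is grouped by its value.
  choose T hT hTa hTr using fun ω : SimpleGraph (Fin n) => ω.exists_isAcyclic_reachable_eq_le
  rw [rcZOn_eq_sum_filter, rcZOn_eq_sum_filter, Finset.mul_sum, ← hp]
  rw [← Finset.sum_fiberwise_of_maps_to (t := Finset.univ.filter (· ∈ acyclicGraphs n)) (g := T)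
    fun ω _ => Finset.mem_filter.2 ⟨Finset.mem_univ _, hTa ω⟩]
  refine Finset.sum_le_sum fun F hF => ?_
  by_cases hFr : F ∈ smallComponents n r
  · calc _ = ∑ ω ∈ (Finset.univ.filter (· ∈ smallComponents n r)).filter (T · = F),
            edgeWeight p ω * q ^ Nat.card F.ConnectedComponent := by
          refine Finset.sum_congr rfl fun ω hω => ?_
          rw [rcWeight_eq_edgeWeight_mul, ← card_connectedComponent_congr (hTr ω),
            (Finset.mem_filter.1 hω).2]
      _ ≤ p ^ F.edgeSet.ncard * (1 - p) ^ (n.choose 2 - (componentClosure F).edgeSet.ncard) *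
            q ^ Nat.card F.ConnectedComponent := by
          rw [← Finset.sum_mul]
          refine mul_le_mul_of_nonneg_right ?_ (by positivity)
          refine sum_edgeWeight_le (F := F) (H := componentClosure F) h0.le h1.le
            (fun u v h => ⟨h.ne, h.reachable⟩) _ fun ω hω => ?_
          have hω' := (Finset.mem_filter.1 hω).2
          subst hω'
          refine ⟨hT ω, fun u v h => ⟨h.ne, ?_⟩⟩
          rw [hTr]
          exact h.reachable
      _ ≤ _ := by
          rw [rcWeight_eq_edgeWeight_mul, edgeWeight_eq, ← mul_assoc]
          refine mul_le_mul_of_nonneg_right ?_ (by positivity)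
          rw [mul_left_comm]
          refine mul_le_mul_of_nonneg_left ?_ (by positivity)
          rw [← Real.rpow_natCast, ← Real.rpow_natCast, ← Real.rpow_add hs]
          -- The base is below `1`, so it remains to see that the closure has at most `nr` more
          -- edges than `F`.
          refine Real.rpow_le_rpow_of_exponent_ge hs (by linarith) ?_
          rw [Nat.cast_sub (ncard_edgeSet_le _), Nat.cast_sub (ncard_edgeSet_le _)]
          have := ncard_edgeSet_componentClosure_le hFr
          have : (0 : ℝ) ≤ F.edgeSet.ncard := Nat.cast_nonneg _
          linarith
  -- The fibre is empty: `F` has the same components as every `ω` above it.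
  · rw [Finset.sum_eq_zero fun ω hω => ?_]
    · exact mul_nonneg (Real.rpow_nonneg hs.le _) (rcWeight_pos hq h0 h1 F).le
    · rw [Finset.filter_filter, Finset.mem_filter] at hω
      refine (hFr ?_).elim
      have := hω.2.1
      rw [smallComponents_iff, ← hTr ω, hω.2.2] at this
      exact smallComponents_iff.2 this

/-! ### Forest weights in terms of the number of components. -/

/-- The edge number is `n - k`. The factor kept on the left, between `(1 - p) ^ n` and `1`, is all
that separates `rcZOn` from `compSum` in the next two bounds. -/
theorem rcWeight_of_isAcyclic {n : ℕ} {p q : ℝ} (h0 : 0 < p)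
    {F : SimpleGraph (Fin n)} (hF : F.IsAcyclic) :
    rcWeight n p q F * (1 - p) ^ F.edgeSet.ncard
      = p ^ n * (1 - p) ^ n.choose 2 * (q / p) ^ Nat.card F.ConnectedComponent := by
  have hc := hF.ncard_edgeSet_add_card
  rw [Nat.card_fin] at hc
  have hM := ncard_edgeSet_le F
  rw [rcWeight_eq_edgeWeight_mul, edgeWeight_eq]
  generalize F.edgeSet.ncard = e at *
  generalize Nat.card F.ConnectedComponent = k at *
  obtain ⟨d, hd⟩ := Nat.exists_eq_add_of_le hM
  rw [hd, ← hc, Nat.add_sub_cancel_left, div_pow, pow_add, pow_add]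
  have := h0.ne'
  field_simp

theorem le_rcZOn {n : ℕ} {lam q : ℝ} (hq : 0 < q) (h0 : 0 < lam / n) (h1 : lam / n < 1)
    {A : (n : ℕ) → Set (SimpleGraph (Fin n))} (hA : A n ⊆ acyclicGraphs n) :
    (lam / n) ^ n * (1 - lam / n) ^ n.choose 2 * compSum A n (q / (lam / n))
      ≤ rcZOn n lam q (A n) := by
  classical
  rw [rcZOn_eq_sum_filter, compSum, Finset.mul_sum]
  refine Finset.sum_le_sum fun F hF => ?_
  rw [← rcWeight_of_isAcyclic h0 (hA (Finset.mem_filter.1 hF).2)]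
  exact mul_le_of_le_one_right (rcWeight_pos hq h0 h1 F).le
    (pow_le_one₀ (by linarith) (by linarith))

theorem rcZOn_le {n : ℕ} {lam q : ℝ} (hq : 0 < q) (h0 : 0 < lam / n) (h1 : lam / n < 1)
    {A : (n : ℕ) → Set (SimpleGraph (Fin n))} (hA : A n ⊆ acyclicGraphs n) :
    rcZOn n lam q (A n) * (1 - lam / n) ^ n
      ≤ (lam / n) ^ n * (1 - lam / n) ^ n.choose 2 * compSum A n (q / (lam / n)) := by
  classical
  rw [rcZOn_eq_sum_filter, compSum, Finset.mul_sum, Finset.sum_mul]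
  refine Finset.sum_le_sum fun F hF => ?_
  have hFa := hA (Finset.mem_filter.1 hF).2
  rw [← rcWeight_of_isAcyclic h0 hFa]
  refine mul_le_mul_of_nonneg_left (pow_le_pow_of_le_one (by linarith) (by linarith) ?_)
    (rcWeight_pos hq h0 h1 F).le
  have hc := SimpleGraph.IsAcyclic.ncard_edgeSet_add_card hFa
  rw [Nat.card_fin] at hc
  omega

/-- For `q = 1` this is a probability; it supplies the a priori bound on the number of forests. -/
theorem rcZOn_one_le {n : ℕ} {lam : ℝ} (h0 : 0 < lam / n) (h1 : lam / n < 1)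
    (A : Set (SimpleGraph (Fin n))) : rcZOn n lam 1 A ≤ 1 := by
  classical
  have ht : (⊤ : SimpleGraph (Fin n)).edgeSet.ncard = n.choose 2 := by
    rw [← SimpleGraph.coe_edgeFinset, Set.ncard_coe_finset,
      SimpleGraph.card_edgeFinset_top_eq_card_choose_two, Fintype.card_fin]
  rw [rcZOn_eq_sum_filter]
  simp_rw [rcWeight_eq_edgeWeight_mul, one_pow, mul_one]
  refine (sum_edgeWeight_le h0.le h1.le (bot_le (a := (⊤ : SimpleGraph (Fin n)))) _
    fun ω _ => ⟨bot_le, le_top⟩).trans ?_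
  rw [ht]
  simp

theorem compSum_pos {A : (n : ℕ) → Set (SimpleGraph (Fin n))} {n : ℕ} (hA : (A n).Nonempty)
    {t : ℝ} (ht : 0 < t) : 0 < compSum A n t := by
  classical
  obtain ⟨F, hF⟩ := hA
  exact Finset.sum_pos (fun F _ => by positivity)
    ⟨F, Finset.mem_filter.2 ⟨Finset.mem_univ _, hF⟩⟩

theorem compSum_le_mul {A : (n : ℕ) → Set (SimpleGraph (Fin n))} {n : ℕ} {s t c : ℝ} (hs : 0 ≤ s)
    (hc : 1 ≤ c) (ht : 0 ≤ t) (hst : s ≤ c * t) : compSum A n s ≤ c ^ n * compSum A n t := by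
  classical
  rw [compSum, compSum, Finset.mul_sum]
  refine Finset.sum_le_sum fun F _ => ?_
  calc s ^ Nat.card F.ConnectedComponent ≤ (c * t) ^ Nat.card F.ConnectedComponent :=
        pow_le_pow_left₀ hs hst _
    _ = c ^ Nat.card F.ConnectedComponent * t ^ Nat.card F.ConnectedComponent := mul_pow _ _ _
    _ ≤ _ := by
        refine mul_le_mul_of_nonneg_right (pow_le_pow_right₀ hc ?_) (by positivity)
        have : Nat.card F.ConnectedComponent ≤ Nat.card (Fin n) :=
          Nat.card_le_card_of_surjective F.connectedComponentMk Quot.mk_surjective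
        simpa using this

/-! ### The component rate: existence of the limit and truncation. -/

/-- The exponential rate of the number of graphs of a family, each component counted with
multiplicity `t * n`, relative to `n !`. -/
def componentRate (A : (n : ℕ) → Set (SimpleGraph (Fin n))) (t : ℝ) (n : ℕ) : ℝ :=
  Real.log (compSum A n (t * n) / n.factorial) / n

theorem compSum_mul_self_pos {A : (n : ℕ) → Set (SimpleGraph (Fin n))} {n : ℕ}
    (hA : (A n).Nonempty) {t : ℝ} (ht : 0 < t) : 0 < compSum A n (t * n) := by
  classical
  -- At `n = 0` the weight `t * n` vanishes, but the empty graph has no component and contributes `0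
  -- ^ 0 = 1`.
  rcases Nat.eq_zero_or_pos n with rfl | hn
  · obtain ⟨F, hF⟩ := hA
    refine Finset.sum_pos (fun F _ => ?_) ⟨F, Finset.mem_filter.2 ⟨Finset.mem_univ _, hF⟩⟩
    have : IsEmpty F.ConnectedComponent := ⟨fun c => c.ind fun v => v.elim0⟩
    simp
  · exact compSum_pos hA (by positivity)

/-- The weight `t * n` is additive in `n`, as `compSum_mul_le` requires, and dividing by `n!`
absorbs the binomial coefficient. -/
theorem subadditive_neg_log_compSum {A : (n : ℕ) → Set (SimpleGraph (Fin n))} (hA : SumClosed A)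
    (hne : ∀ n, (A n).Nonempty) {t : ℝ} (ht : 0 < t) :
    Subadditive fun n => -Real.log (compSum A n (t * n) / n.factorial) := by
  intro m n
  have hm := compSum_mul_self_pos (hne m) ht
  have hn := compSum_mul_self_pos (hne n) ht
  have key := compSum_mul_le hA m n (x := t * m) (y := t * n) (by positivity) (by positivity)
  rw [← mul_add, ← Nat.cast_add] at key
  have hfac : ((m + n).choose m : ℝ) * (m.factorial * n.factorial) = (m + n).factorial := by
    rw [← mul_assoc, Nat.choose_symm_add]
    exact_mod_cast Nat.add_choose_mul_factorial_mul_factorial m n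
  rw [← neg_add, neg_le_neg_iff, ← Real.log_mul (by positivity) (by positivity)]
  refine Real.log_le_log (by positivity) ?_
  rw [div_mul_div_comm, div_le_div_iff₀ (by positivity) (by positivity), ← hfac]
  calc _ = ((m + n).choose m * (compSum A m (t * m) * compSum A n (t * n))) *
        (m.factorial * n.factorial) := by ring
    _ ≤ _ := by gcongr

theorem neg_log_one_sub_le {p : ℝ} (h0 : 0 ≤ p) (h1 : p ≤ 1 / 2) : -Real.log (1 - p) ≤ 2 * p := by
  have h := Real.one_sub_inv_le_log_of_pos (x := 1 - p) (by linarith)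
  have : (1 - p)⁻¹ ≤ 1 + 2 * p := by
    rw [inv_le_iff_one_le_mul₀ (by linarith)]
    nlinarith
  linarith

theorem le_log_factorial (n : ℕ) : n * Real.log n - n ≤ Real.log n.factorial := by
  rcases Nat.eq_zero_or_pos n with rfl | hn
  · simp
  have h := Real.pow_div_factorial_le_exp (x := (n : ℝ)) (Nat.cast_nonneg _) n
  have h' := Real.log_le_log (by positivity) h
  rw [Real.log_div (by positivity) (by positivity), Real.log_pow, Real.log_exp] at h'
  linarith

theorem cast_choose_two (n : ℕ) : ((n.choose 2 : ℕ) : ℝ) = n * (n - 1) / 2 := Nat.cast_choose_two ℝ n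

/-- Take cluster weight `1` and edge parameter `1 / t`, so that `q/p = t * n`, and use that the mass
is at most `1`; `2 / t ≤ n` ensures `p ≤ 1/2`. -/
theorem componentRate_le {A : (n : ℕ) → Set (SimpleGraph (Fin n))} {n : ℕ}
    (hne : (A n).Nonempty) (hA : A n ⊆ acyclicGraphs n) {t : ℝ} (ht : 0 < t) (hn : 2 / t ≤ n) :
    componentRate A t n ≤ Real.log t + 1 / t + 1 := by
  have hn0 : (0 : ℝ) < n := lt_of_lt_of_le (by positivity) hn
  have hp : 1 / t / n ≤ 1 / 2 := by
    rw [div_le_iff₀ ht] at hn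
    rw [div_div, div_le_div_iff₀ (by positivity) (by positivity)]
    linarith
  have hp0 : 0 < 1 / t / n := by positivity
  have h := (le_rcZOn one_pos hp0 (by linarith) hA).trans (rcZOn_one_le hp0 (by linarith) (A n))
  have he : 1 / (1 / t / n) = t * n := by field_simp
  rw [he] at h
  have hX := compSum_mul_self_pos hne ht
  have h1 : 0 < 1 - 1 / t / n := by linarith
  have h' := Real.log_le_log (by positivity) h
  rw [Real.log_one, Real.log_mul (by positivity) (by positivity),
    Real.log_mul (by positivity) (by positivity), Real.log_pow, Real.log_pow, cast_choose_two,
    div_div, one_div, Real.log_inv, Real.log_mul ht.ne' hn0.ne', ← one_div, ← div_div] at h'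
  have h2 := neg_log_one_sub_le hp0.le hp
  have h3 := le_log_factorial n
  rw [componentRate, Real.log_div hX.ne' (by positivity), div_le_iff₀ hn0]
  have h4 : (n : ℝ) * (n - 1) / 2 * -Real.log (1 - 1 / t / n) ≤ n / t := by
    have hL : 0 ≤ -Real.log (1 - 1 / t / n) := by
      have := Real.log_nonpos h1.le (by linarith)
      linarith
    calc _ ≤ (n : ℝ) * n / 2 * (2 * (1 / t / n)) := by
          refine mul_le_mul ?_ h2 hL (by positivity)
          nlinarith
      _ = n / t := by field_simp
  have h5 : (Real.log t + 1 / t + 1) * n = n * Real.log t + n / t + n := by ring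
  rw [h5]
  nlinarith

/-- Changing `t` to `s` costs at most `exp |log s - log t|` for each of at most `n` components. -/
theorem componentRate_le_add {A : (n : ℕ) → Set (SimpleGraph (Fin n))} {n : ℕ}
    (hne : (A n).Nonempty) {s t : ℝ} (hs : 0 < s) (ht : 0 < t) :
    componentRate A s n ≤ componentRate A t n + |Real.log s - Real.log t| := by
  rcases Nat.eq_zero_or_pos n with rfl | hn
  · simp [componentRate]
  have hn' : (0 : ℝ) < n := Nat.cast_pos.2 hn
  have hS := compSum_mul_self_pos hne hs
  have hT := compSum_mul_self_pos hne ht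
  have hle : s * n ≤ Real.exp |Real.log s - Real.log t| * (t * n) := by
    rw [← mul_assoc]
    refine mul_le_mul_of_nonneg_right ?_ hn'.le
    calc s = Real.exp (Real.log s - Real.log t) * t := by
          rw [Real.exp_sub, Real.exp_log hs, Real.exp_log ht]; field_simp
      _ ≤ _ := by gcongr; exact le_abs_self _
  have h := compSum_le_mul (A := A) (n := n) (by positivity)
    (Real.one_le_exp (abs_nonneg (Real.log s - Real.log t))) (by positivity) hle
  have h' := Real.log_le_log hS h
  rw [Real.log_mul (by positivity) hT.ne', Real.log_pow, Real.log_exp] at h'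
  rw [componentRate, componentRate, Real.log_div hS.ne' (by positivity),
    Real.log_div hT.ne' (by positivity), div_add' _ _ _ hn'.ne', div_le_div_iff_of_pos_right hn']
  linarith

theorem abs_componentRate_sub_le {A : (n : ℕ) → Set (SimpleGraph (Fin n))} {n : ℕ}
    (hne : (A n).Nonempty) {s t : ℝ} (hs : 0 < s) (ht : 0 < t) :
    |componentRate A s n - componentRate A t n| ≤ |Real.log s - Real.log t| := by
  have h1 := componentRate_le_add hne hs ht
  have h2 := componentRate_le_add hne ht hs
  rw [abs_sub_comm (Real.log t)] at h2
  rw [abs_le]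
  constructor <;> linarith

theorem componentRate_mono {A B : (n : ℕ) → Set (SimpleGraph (Fin n))} {n : ℕ}
    (hne : (A n).Nonempty) (hAB : A n ⊆ B n) {t : ℝ} (ht : 0 < t) :
    componentRate A t n ≤ componentRate B t n := by
  classical
  have := compSum_mul_self_pos hne ht
  refine div_le_div_of_nonneg_right (Real.log_le_log (by positivity) ?_) (Nat.cast_nonneg _)
  refine div_le_div_of_nonneg_right ?_ (Nat.cast_nonneg _)
  refine Finset.sum_le_sum_of_subset_of_nonneg ?_ fun ω _ _ => by positivity
  exact fun ω hω => Finset.mem_filter.2 ⟨Finset.mem_univ _, hAB (Finset.mem_filter.1 hω).2⟩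

theorem acyclicGraphs_nonempty (n : ℕ) : (acyclicGraphs n).Nonempty :=
  ⟨⊥, SimpleGraph.isAcyclic_bot⟩

/-- Forests whose components have at most `r` vertices. -/
def smallForests (r : ℝ) (n : ℕ) : Set (SimpleGraph (Fin n)) :=
  acyclicGraphs n ∩ smallComponents n r

theorem smallForests_nonempty {r : ℝ} (hr : 1 ≤ r) (n : ℕ) : (smallForests r n).Nonempty :=
  ⟨⊥, SimpleGraph.isAcyclic_bot, bot_mem_smallComponents hr⟩

theorem smallComponents_mono {n : ℕ} {r s : ℝ} (hrs : r ≤ s) :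
    smallComponents n r ⊆ smallComponents n s :=
  fun _ hω c => (hω c).trans hrs

theorem smallForests_mono {n : ℕ} {r s : ℝ} (hrs : r ≤ s) :
    smallForests r n ⊆ smallForests s n :=
  Set.inter_subset_inter_right _ (smallComponents_mono hrs)

theorem smallForests_natCast_self (n : ℕ) : smallForests n n = acyclicGraphs n := by
  refine Set.inter_eq_left.2 fun ω _ c => Nat.cast_le.2 ?_
  simpa using Set.ncard_le_card c.supp

theorem exists_tendsto_componentRate {t : ℝ} (ht : 0 < t) :
    ∃ v, Tendsto (componentRate acyclicGraphs t) atTop (𝓝 v) := by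
  have hsub := subadditive_neg_log_compSum sumClosed_acyclicGraphs acyclicGraphs_nonempty ht
  have hev : ∀ᶠ n : ℕ in atTop, -(Real.log t + 1 / t + 1) ≤
      -Real.log (compSum acyclicGraphs n (t * n) / n.factorial) / n := by
    filter_upwards [tendsto_natCast_atTop_atTop.eventually_ge_atTop (2 / t)] with n hn
    have := componentRate_le (acyclicGraphs_nonempty n) subset_rfl ht hn
    rw [componentRate] at this
    rw [neg_div]
    linarith
  have hbdd : BddBelow (Set.range fun n : ℕ =>
      -Real.log (compSum acyclicGraphs n (t * n) / n.factorial) / n) :=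
    IsBoundedUnder.bddBelow_range ⟨_, hev⟩
  refine ⟨_, (hsub.tendsto_lim hbdd).neg.congr fun n => ?_⟩
  rw [componentRate, neg_div, neg_neg]

/-- Choose `n₀` where the forest rate already exceeds `a`, and take `r = n₀`: on `n₀` vertices the
size constraint is void. Subadditivity for `smallForests n₀` carries the bound from this single `n₀`
to all large `n`. -/
theorem exists_lt_componentRate_smallForests {t v a : ℝ} (ht : 0 < t)
    (hv : Tendsto (componentRate acyclicGraphs t) atTop (𝓝 v)) (ha : a < v) :
    ∃ r : ℝ, 1 ≤ r ∧ ∀ᶠ n in atTop, a < componentRate (smallForests r) t n := by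
  obtain ⟨n₀, hn₀, hpos⟩ := ((hv.eventually_const_lt ha).and (eventually_ge_atTop 1)).exists
  have hr : (1 : ℝ) ≤ n₀ := by exact_mod_cast hpos
  refine ⟨n₀, hr, ?_⟩
  have hsub := subadditive_neg_log_compSum
    (sumClosed_acyclicGraphs.inter (sumClosed_smallComponents n₀)) (smallForests_nonempty hr) ht
  have hlt : -Real.log (compSum (smallForests n₀) n₀ (t * n₀) / n₀.factorial) / n₀ < -a := by
    have : componentRate (smallForests n₀) t n₀ = componentRate acyclicGraphs t n₀ := by
      rw [componentRate, componentRate, compSum, compSum, smallForests_natCast_self]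
    rw [← this, componentRate] at hn₀
    rw [neg_div]
    linarith
  filter_upwards [hsub.eventually_div_lt_of_div_lt (by omega) hlt] with n hn
  rw [neg_div, neg_lt_neg_iff] at hn
  exact hn

/-! ### Uniformity on compact sets. -/

/-- The exponential growth rate of forests with weight `t * n` per component. -/
def forestRate (t : ℝ) : ℝ := open Classical in
  if ht : 0 < t then (exists_tendsto_componentRate ht).choose else 0

theorem tendsto_forestRate {t : ℝ} (ht : 0 < t) :
    Tendsto (componentRate acyclicGraphs t) atTop (𝓝 (forestRate t)) := by
  rw [forestRate, dif_pos ht]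
  exact (exists_tendsto_componentRate ht).choose_spec

theorem abs_forestRate_sub_le {s t : ℝ} (hs : 0 < s) (ht : 0 < t) :
    |forestRate s - forestRate t| ≤ |Real.log s - Real.log t| :=
  le_of_tendsto ((tendsto_forestRate hs).sub (tendsto_forestRate ht)).abs
    (Eventually.of_forall fun n => abs_componentRate_sub_le (acyclicGraphs_nonempty n) hs ht)

theorem componentRate_uniform {K : Set ℝ} (hK : IsCompact K) (hK0 : K ⊆ Set.Ioi 0) {δ : ℝ}
    (hδ : 0 < δ) : ∃ r : ℝ, 1 ≤ r ∧ ∀ᶠ n in atTop, ∀ t ∈ K,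
      |componentRate acyclicGraphs t n - forestRate t| < δ ∧
        forestRate t - δ < componentRate (smallForests r) t n := by
  -- Positivity moves inside the statement because the neighbourhoods used in the compactness
  -- induction may leave the half-line.
  suffices h : ∃ r : ℝ, 1 ≤ r ∧ ∀ᶠ n in atTop, ∀ t ∈ K, 0 < t →
      |componentRate acyclicGraphs t n - forestRate t| < δ ∧
        forestRate t - δ < componentRate (smallForests r) t n by
    obtain ⟨r, hr, h⟩ := h
    exact ⟨r, hr, h.mono fun n hn t ht => hn t ht (hK0 ht)⟩
  refine hK.induction_on (p := fun S => ∃ r : ℝ, 1 ≤ r ∧ ∀ᶠ n in atTop, ∀ t ∈ S, 0 < t →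
      |componentRate acyclicGraphs t n - forestRate t| < δ ∧
        forestRate t - δ < componentRate (smallForests r) t n) ?_ ?_ ?_ ?_
  · exact ⟨1, le_rfl, by simp⟩
  · rintro S T hST ⟨r, hr, h⟩
    exact ⟨r, hr, h.mono fun n hn t ht => hn t (hST ht)⟩
  · rintro S T ⟨r, hr, h⟩ ⟨s, hs, h'⟩
    refine ⟨max r s, hr.trans (le_max_left _ _), ?_⟩
    filter_upwards [h, h'] with n hn hn' t ht ht0
    rcases ht with ht | ht
    · exact ⟨(hn t ht ht0).1, (hn t ht ht0).2.trans_le (componentRate_mono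
        (smallForests_nonempty hr n) (smallForests_mono (le_max_left _ _)) ht0)⟩
    · exact ⟨(hn' t ht ht0).1, (hn' t ht ht0).2.trans_le (componentRate_mono
        (smallForests_nonempty hs n) (smallForests_mono (le_max_right _ _)) ht0)⟩
  · intro t ht
    have ht0 : 0 < t := hK0 ht
    obtain ⟨r, hr, h⟩ := exists_lt_componentRate_smallForests ht0 (tendsto_forestRate ht0)
      (show forestRate t - δ / 4 < forestRate t by linarith)
    have hU : ∀ᶠ s in 𝓝 t, |Real.log s - Real.log t| < δ / 4 := by
      have := Metric.tendsto_nhds.1 (Real.continuousAt_log ht0.ne').tendsto (δ / 4) (by linarith)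
      simpa [Real.dist_eq] using this
    -- From `s` to `t` at finite `n`, to the limit at `t`, and back to `s`: three errors of size `δ
    -- / 4`.
    refine ⟨{s | |Real.log s - Real.log t| < δ / 4}, mem_nhdsWithin_of_mem_nhds hU, r, hr, ?_⟩
    have hlim := Metric.tendsto_nhds.1 (tendsto_forestRate ht0) (δ / 4) (by linarith)
    filter_upwards [h, hlim] with n hn hn' s hs hs0
    rw [Real.dist_eq] at hn'
    have hs : |Real.log s - Real.log t| < δ / 4 := hs
    have h1 := abs_le.1 (abs_componentRate_sub_le (acyclicGraphs_nonempty n) hs0 ht0)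
    have h2 := abs_le.1 (abs_componentRate_sub_le (smallForests_nonempty hr n) hs0 ht0)
    have h3 := abs_le.1 (abs_forestRate_sub_le hs0 ht0)
    have h4 := abs_lt.1 hn'
    refine ⟨abs_lt.2 ⟨?_, ?_⟩, ?_⟩ <;> linarith [h1.1, h1.2, h2.1, h2.2, h3.1, h3.2, h4.1, h4.2]

/-! ### From the component rate to `logRate`. -/

theorem tendsto_log_factorial_div_sub_log :
    Tendsto (fun n : ℕ => Real.log n.factorial / n - Real.log n + 1) atTop (𝓝 0) := by
  have hn : Tendsto (fun n : ℕ => (n : ℝ)) atTop atTop := tendsto_natCast_atTop_atTop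
  have h1 : Tendsto (fun n : ℕ => Real.log (Stirling.stirlingSeq n) / n) atTop (𝓝 0) :=
    ((Real.continuousAt_log (by positivity)).tendsto.comp
      Stirling.tendsto_stirlingSeq_sqrt_pi).div_atTop hn
  have h2 : Tendsto (fun n : ℕ => Real.log (2 * n) / (2 * n)) atTop (𝓝 0) := by
    have := Real.isLittleO_log_id_atTop.tendsto_div_nhds_zero
    exact this.comp (hn.const_mul_atTop two_pos)
  have h3 := h1.add h2
  rw [add_zero] at h3
  refine h3.congr' ?_
  filter_upwards [eventually_ge_atTop 1] with n hn
  have hn' : (0 : ℝ) < n := by exact_mod_cast hn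
  rw [Stirling.log_stirlingSeq_formula, Real.log_div hn'.ne' (Real.exp_pos 1).ne', Real.log_exp]
  field_simp
  ring

/-- Comparison of the rate of a family of forests with its component rate. -/
theorem abs_logRate_sub_componentRate_le {A : (n : ℕ) → Set (SimpleGraph (Fin n))} {n : ℕ}
    {lam q : ℝ} (hq : 0 < q) (hlam : 0 < lam) (hn : 2 * lam ≤ n) (hn1 : 1 ≤ n)
    (hne : (A n).Nonempty) (hA : A n ⊆ acyclicGraphs n) :
    |logRate lam q n (A n) - componentRate A (q / lam) n - (Real.log lam - lam / 2 - 1)|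
      ≤ |Real.log n.factorial / n - Real.log n + 1| + (lam ^ 2 + 3 * lam) / n := by
  have hn0 : (0 : ℝ) < n := by exact_mod_cast hn1
  have hn1' : (1 : ℝ) ≤ n := by exact_mod_cast hn1
  set p := lam / n with hp
  have hp0 : 0 < p := by positivity
  have hp2 : p ≤ 1 / 2 := by
    rw [hp, div_le_div_iff₀ hn0 two_pos]
    linarith
  have hs : 0 < 1 - p := by linarith
  have he : q / p = q / lam * n := by rw [hp]; field_simp
  have hX := compSum_mul_self_pos hne (div_pos hq hlam)
  have hZ : 0 < rcZOn n lam q (A n) := rcZOn_pos hq hp0 (by linarith) hne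
  have h1 := le_rcZOn hq hp0 (by linarith) hA
  have h2 := rcZOn_le hq hp0 (by linarith) hA
  rw [← hp, he] at h1 h2
  have h1 := Real.log_le_log (by positivity) h1
  have h2 := Real.log_le_log (by positivity) h2
  rw [Real.log_mul (by positivity) (by positivity), Real.log_mul (by positivity) (by positivity),
    Real.log_pow, Real.log_pow, cast_choose_two] at h1
  rw [Real.log_mul hZ.ne' (by positivity), Real.log_mul (by positivity) (by positivity),
    Real.log_mul (by positivity) (by positivity), Real.log_pow, Real.log_pow, Real.log_pow,
    cast_choose_two] at h2
  have hlp : Real.log p = Real.log lam - Real.log n := Real.log_div hlam.ne' hn0.ne'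
  rw [hlp] at h1 h2
  rw [logRate, componentRate, Real.log_div hX.ne' (by positivity)]
  generalize Real.log (compSum A n (q / lam * n)) = X at *
  generalize Real.log (rcZOn n lam q (A n)) = Z at *
  have hl1 : p ≤ -Real.log (1 - p) := by
    have := Real.log_le_sub_one_of_pos hs
    linarith
  have hl2 : -Real.log (1 - p) ≤ p + 2 * p ^ 2 := by
    have h := Real.one_sub_inv_le_log_of_pos hs
    have : (1 - p)⁻¹ ≤ 1 + p + 2 * p ^ 2 := by
      rw [inv_le_iff_one_le_mul₀ hs]
      nlinarith [sq_nonneg p, mul_nonneg (sq_nonneg p) (show 0 ≤ 1 - 2 * p by linarith)]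
    linarith
  generalize Real.log (1 - p) = l at *
  have hlam' : lam = p * n := by rw [hp]; field_simp
  -- Three errors: the edge factor, between `0` and `-l ≤ p + 2 p ^ 2`; Stirling; and the
  -- replacement of `(n - 1) / 2 * log (1 - p)` by `-lam / 2`. The first and third together are at
  -- most `p * lam + 3 * p` in absolute value.
  have hD : 1 / (n : ℝ) * Z - (X - Real.log n.factorial) / n - (Real.log lam - lam / 2 - 1)
      = (Z - (n * (Real.log lam - Real.log n) + n * (n - 1) / 2 * l + X)) / n
        + (Real.log n.factorial / n - Real.log n + 1) + ((n - 1) / 2 * l + lam / 2) := by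
    field_simp
    ring
  have hD1 : 0 ≤ (Z - (n * (Real.log lam - Real.log n) + n * (n - 1) / 2 * l + X)) / n :=
    div_nonneg (by linarith) hn0.le
  have hD2 : (Z - (n * (Real.log lam - Real.log n) + n * (n - 1) / 2 * l + X)) / n ≤ -l := by
    rw [div_le_iff₀ hn0]
    linarith
  have hE : (lam ^ 2 + 3 * lam) / n = p * lam + 3 * p := by rw [hp]; field_simp
  have hS1 := le_abs_self (Real.log n.factorial / n - Real.log n + 1)
  have hS2 := neg_abs_le (Real.log n.factorial / n - Real.log n + 1)
  have hb1 : ((n : ℝ) - 1) / 2 * l ≤ (n - 1) / 2 * -p :=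
    mul_le_mul_of_nonneg_left (by linarith) (by linarith)
  have hb2 : ((n : ℝ) - 1) / 2 * -(p + 2 * p ^ 2) ≤ (n - 1) / 2 * l :=
    mul_le_mul_of_nonneg_left (by linarith) (by linarith)
  have hb3 : ((n : ℝ) - 1) / 2 * -p = p / 2 - lam / 2 := by rw [hlam']; ring
  have hb4 : ((n : ℝ) - 1) / 2 * -(p + 2 * p ^ 2) = p / 2 - lam / 2 - p * lam + p ^ 2 := by
    rw [hlam']; ring
  have hp3 : 2 * p ^ 2 ≤ p := by nlinarith
  have hpl : 0 < p * lam := by positivity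
  have hpp : 0 ≤ p ^ 2 := sq_nonneg p
  rw [hD, hE, abs_le]
  constructor <;> linarith

/-- Here `r` may depend on `n`: the cost vanishes for fixed `r`, and equals `2 * ε * lam` for `r = ε
* n`. -/
theorem logRate_smallComponents_le {n : ℕ} {lam q r : ℝ} (hq : 0 < q) (hlam : 0 < lam)
    (hn : 2 * lam ≤ n) (hr : 0 ≤ r) (hne : (smallComponents n r).Nonempty) :
    logRate lam q n (smallComponents n r)
      ≤ logRate lam q n (acyclicGraphs n) + 2 * r * lam / n := by
  have hn0 : (0 : ℝ) < n := lt_of_lt_of_le (by positivity) hn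
  have hp0 : 0 < lam / n := by positivity
  have hp2 : lam / n ≤ 1 / 2 := by
    rw [div_le_div_iff₀ hn0 two_pos]
    linarith
  have hs : 0 < 1 - lam / n := by linarith
  have hL := rcZOn_pos hq hp0 (by linarith) (acyclicGraphs_nonempty n)
  have h := Real.log_le_log (rcZOn_pos hq hp0 (by linarith) hne)
    (rcZOn_smallComponents_le (r := r) hq hp0 (by linarith))
  rw [Real.log_mul (by positivity) hL.ne', Real.log_rpow hs] at h
  have hl := neg_log_one_sub_le hp0.le hp2
  have h' : -(n * r) * Real.log (1 - lam / n) ≤ n * r * (2 * (lam / n)) := by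
    rw [neg_mul_comm]
    exact mul_le_mul_of_nonneg_left hl (by positivity)
  rw [logRate, logRate]
  calc _ ≤ 1 / (n : ℝ) * (n * r * (2 * (lam / n)) + Real.log (rcZOn n lam q (acyclicGraphs n))) :=
        mul_le_mul_of_nonneg_left (h.trans (by linarith)) (by positivity)
    _ = _ := by field_simp; ring

theorem logRate_mono {n : ℕ} {lam q : ℝ} (hq : 0 < q) (hlam : 0 < lam) (hn : 2 * lam ≤ n)
    {A B : Set (SimpleGraph (Fin n))} (hA : A.Nonempty) (hAB : A ⊆ B) :
    logRate lam q n A ≤ logRate lam q n B := by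
  have hn0 : (0 : ℝ) < n := lt_of_lt_of_le (by positivity) hn
  have hp0 : 0 < lam / n := by positivity
  have hp1 : lam / n < 1 := by
    rw [div_lt_one hn0]
    linarith
  exact mul_le_mul_of_nonneg_left (Real.log_le_log (rcZOn_pos hq hp0 hp1 hA)
    (rcZOn_mono hq hp0 hp1 hAB)) (by positivity)

/-- The exponential rate of the acyclic event. -/
def acyclicRate (q lam : ℝ) : ℝ :=
  -- The bracket is the limit of `(1/n) log (p ^ n (1 - p) ^ (n choose 2) n!)`.
  forestRate (q / lam) + (Real.log lam - lam / 2 - 1)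

theorem logRate_uniform {q : ℝ} (hq : 0 < q) {K : Set ℝ} (hK : IsCompact K) (hK0 : K ⊆ Set.Ioi 0)
    {δ : ℝ} (hδ : 0 < δ) : ∃ r : ℝ, 1 ≤ r ∧ ∀ᶠ n in atTop, ∀ lam ∈ K,
      |logRate lam q n (acyclicGraphs n) - acyclicRate q lam| < δ ∧
        acyclicRate q lam - δ < logRate lam q n (smallForests r n) := by
  obtain ⟨B, hB⟩ := hK.bddAbove
  have hK' : IsCompact ((fun lam => q / lam) '' K) :=
    hK.image_of_continuousOn (continuousOn_const.div continuousOn_id fun x hx => (hK0 hx).ne')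
  obtain ⟨r, hr, h⟩ := componentRate_uniform hK' (by
    rintro _ ⟨x, hx, rfl⟩
    exact div_pos hq (hK0 hx)) (half_pos hδ)
  refine ⟨r, hr, ?_⟩
  have herr : Tendsto (fun n : ℕ => |Real.log n.factorial / n - Real.log n + 1| +
      (B ^ 2 + 3 * B) / n) atTop (𝓝 0) := by
    have h1 := tendsto_log_factorial_div_sub_log.abs
    have h2 : Tendsto (fun n : ℕ => (B ^ 2 + 3 * B) / (n : ℝ)) atTop (𝓝 0) :=
      tendsto_const_nhds.div_atTop tendsto_natCast_atTop_atTop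
    simpa using h1.add h2
  filter_upwards [h, herr.eventually_lt_const (half_pos hδ), eventually_ge_atTop 1,
    tendsto_natCast_atTop_atTop.eventually_ge_atTop (2 * B)] with n hn he hn1 hnB lam hlam
  have h0 : 0 < lam := hK0 hlam
  have hlB : lam ≤ B := hB hlam
  have hcmp : (lam ^ 2 + 3 * lam) / n ≤ (B ^ 2 + 3 * B) / n := by gcongr
  have h1 := abs_le.1 (abs_logRate_sub_componentRate_le (A := acyclicGraphs) hq h0 (by linarith)
    hn1 (acyclicGraphs_nonempty n) subset_rfl)
  have h2 := abs_le.1 (abs_logRate_sub_componentRate_le (A := smallForests r) hq h0 (by linarith)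
    hn1 (smallForests_nonempty hr n) Set.inter_subset_left)
  obtain ⟨h3, h4⟩ := hn _ ⟨lam, hlam, rfl⟩
  have h3 := abs_lt.1 h3
  rw [acyclicRate]
  refine ⟨abs_lt.2 ⟨?_, ?_⟩, ?_⟩ <;> linarith [h1.1, h1.2, h2.1, h2.2, h3.1, h3.2]

theorem logRate_smallComponents_uniform {q : ℝ} (hq : 0 < q) {K : Set ℝ} (hK : IsCompact K)
    (hK0 : K ⊆ Set.Ioi 0) {δ : ℝ} (hδ : 0 < δ) : ∀ᶠ r : ℝ in atTop, ∀ᶠ n : ℕ in atTop,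
      ∀ lam ∈ K, |logRate lam q n (smallComponents n r) - acyclicRate q lam| < δ := by
  obtain ⟨B, hB⟩ := hK.bddAbove
  obtain ⟨r₀, hr₀, h⟩ := logRate_uniform hq hK hK0 (half_pos hδ)
  filter_upwards [eventually_ge_atTop r₀] with r hr
  have herr : Tendsto (fun n : ℕ => (2 * r * B) / (n : ℝ)) atTop (𝓝 0) :=
    tendsto_const_nhds.div_atTop tendsto_natCast_atTop_atTop
  filter_upwards [h, herr.eventually_lt_const (half_pos hδ),
    tendsto_natCast_atTop_atTop.eventually_ge_atTop (2 * B)] with n hn he hnB lam hlam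
  have h0 : 0 < lam := hK0 hlam
  have hlB : lam ≤ B := hB hlam
  obtain ⟨h1, h2⟩ := hn lam hlam
  have h1 := abs_lt.1 h1
  have hsub : smallForests r₀ n ⊆ smallComponents n r :=
    Set.inter_subset_right.trans (smallComponents_mono hr)
  have h3 := logRate_mono hq h0 (by linarith) (smallForests_nonempty hr₀ n) hsub
  have h4 := logRate_smallComponents_le hq h0 (by linarith) (by linarith : 0 ≤ r)
    ((smallForests_nonempty hr₀ n).mono hsub)
  have hcmp : 2 * r * lam / n ≤ 2 * r * B / n := by
    have : 0 ≤ r := by linarith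
    gcongr
  refine abs_lt.2 ⟨?_, ?_⟩ <;> linarith [h1.1, h1.2]

/-- For the lower bound `ε * n` eventually exceeds the fixed `r₀`; for the upper bound `ε` must be
small enough that `2 * ε * B < δ / 2`. -/
theorem logRate_smallComponents_mul_uniform {q : ℝ} (hq : 0 < q) {K : Set ℝ} (hK : IsCompact K)
    (hK0 : K ⊆ Set.Ioi 0) {δ : ℝ} (hδ : 0 < δ) : ∀ᶠ ε : ℝ in 𝓝[>] 0, ∀ᶠ n : ℕ in atTop,
      ∀ lam ∈ K, |logRate lam q n (smallComponents n (ε * n)) - acyclicRate q lam| < δ := by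
  obtain ⟨B, hB⟩ := hK.bddAbove
  obtain ⟨r₀, hr₀, h⟩ := logRate_uniform hq hK hK0 (half_pos hδ)
  have herr : Tendsto (fun ε : ℝ => 2 * ε * B) (𝓝[>] 0) (𝓝 0) := by
    have : Continuous fun ε : ℝ => 2 * ε * B := by fun_prop
    simpa using (this.tendsto 0).mono_left nhdsWithin_le_nhds
  filter_upwards [herr.eventually_lt_const (half_pos hδ), self_mem_nhdsWithin] with ε he hε
  have hε : 0 < ε := hε
  filter_upwards [h, tendsto_natCast_atTop_atTop.eventually_ge_atTop (r₀ / ε),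
    tendsto_natCast_atTop_atTop.eventually_ge_atTop (2 * B)] with n hn hnr hnB lam hlam
  have h0 : 0 < lam := hK0 hlam
  have hlB : lam ≤ B := hB hlam
  have hr : r₀ ≤ ε * n := by
    rwa [div_le_iff₀' hε] at hnr
  have hn0 : (0 : ℝ) < n := by linarith
  obtain ⟨h1, h2⟩ := hn lam hlam
  have h1 := abs_lt.1 h1
  have hsub : smallForests r₀ n ⊆ smallComponents n (ε * n) :=
    Set.inter_subset_right.trans (smallComponents_mono hr)
  have h3 := logRate_mono hq h0 (by linarith) (smallForests_nonempty hr₀ n) hsub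
  have h4 := logRate_smallComponents_le hq h0 (by linarith) (by positivity : 0 ≤ ε * n)
    ((smallForests_nonempty hr₀ n).mono hsub)
  have hcmp : 2 * (ε * n) * lam / n ≤ 2 * ε * B := by
    have : 2 * (ε * n) * lam / n = 2 * ε * lam := by field_simp
    rw [this]
    gcongr
  refine abs_lt.2 ⟨?_, ?_⟩ <;> linarith [h1.1, h1.2]

/-! ### Passage to lower and upper limits in the extended reals. -/

theorem ERealTendstoUniformlyOn.liminf_limsup {ι : Type*} {p : Filter ι} {K : Set ℝ}
    {f : ι → ℕ → ℝ → ℝ} {ell : ℝ → ℝ}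
    (h : ∀ δ : ℝ, 0 < δ → ∀ᶠ i in p, ∀ᶠ n in atTop, ∀ x ∈ K, |f i n x - ell x| < δ) :
    ERealTendstoUniformlyOn (fun i x => liminf (fun n => (f i n x : EReal)) atTop) ell p K ∧
      ERealTendstoUniformlyOn (fun i x => limsup (fun n => (f i n x : EReal)) atTop) ell p K := by
  have key : ∀ δ : ℝ, 0 < δ → ∀ᶠ i in p, ∀ x ∈ K,
      ((ell x - δ : ℝ) : EReal) < liminf (fun n => (f i n x : EReal)) atTop ∧
      limsup (fun n => (f i n x : EReal)) atTop < ((ell x + δ : ℝ) : EReal) := by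
    intro δ hδ
    -- Lower and upper limits preserve only weak inequalities; halving `δ` restores strictness.
    filter_upwards [h (δ / 2) (half_pos hδ)] with i hi x hx
    constructor
    · refine lt_of_lt_of_le (b := ((ell x - δ / 2 : ℝ) : EReal))
        (EReal.coe_lt_coe_iff.2 (by linarith)) (le_liminf_of_le (by isBoundedDefault) ?_)
      filter_upwards [hi] with n hn
      exact EReal.coe_le_coe_iff.2 (by linarith [(abs_lt.1 (hn x hx)).1])
    · refine lt_of_le_of_lt (b := ((ell x + δ / 2 : ℝ) : EReal))
        (limsup_le_of_le (by isBoundedDefault) ?_) (EReal.coe_lt_coe_iff.2 (by linarith))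
      filter_upwards [hi] with n hn
      exact EReal.coe_le_coe_iff.2 (by linarith [(abs_lt.1 (hn x hx)).2])
  constructor <;> intro δ hδ <;> filter_upwards [key δ hδ] with i hi x hx
  · exact ⟨(hi x hx).1, lt_of_le_of_lt (liminf_le_limsup) (hi x hx).2⟩
  · exact ⟨(hi x hx).1.trans_le liminf_le_limsup, (hi x hx).2⟩

theorem ERealTendstoUniformlyOn.tendsto {ι : Type*} {F : ι → ℝ → EReal} {f : ℝ → ℝ}
    {p : Filter ι} {K : Set ℝ} (h : ERealTendstoUniformlyOn F f p K) {x : ℝ} (hx : x ∈ K) :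
    Tendsto (fun i => F i x) p (𝓝 (f x : EReal)) := by
  refine tendsto_order.2 ⟨fun a ha => ?_, fun a ha => ?_⟩
  · obtain ⟨z, haz, hz⟩ := EReal.lt_iff_exists_real_btwn.1 ha
    have hz := EReal.coe_lt_coe_iff.1 hz
    filter_upwards [h (f x - z) (by linarith)] with i hi
    have := (hi x hx).1
    rw [sub_sub_cancel] at this
    exact haz.trans this
  · obtain ⟨z, hz, hza⟩ := EReal.lt_iff_exists_real_btwn.1 ha
    have hz := EReal.coe_lt_coe_iff.1 hz
    filter_upwards [h (z - f x) (by linarith)] with i hi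
    have := (hi x hx).2
    rw [add_sub_cancel] at this
    exact this.trans hza

end

theorem mainTheorem6 (q : ℝ) (hq : 0 < q) :
    ∃ ell : ℝ → ℝ,
      (∀ lam : ℝ, 0 < lam →
        Tendsto (fun n : ℕ => logRate lam q n (acyclicGraphs n)) atTop (𝓝 (ell lam)) ∧
        Tendsto (fun r : ℝ => lowerRate lam q (fun n => smallComponents n r)) atTop
          (𝓝 (ell lam : EReal)) ∧
        Tendsto (fun r : ℝ => upperRate lam q (fun n => smallComponents n r)) atTop
          (𝓝 (ell lam : EReal)) ∧
        Tendsto (fun ε : ℝ => lowerRate lam q (fun n => smallComponents n (ε * n))) (𝓝[>] 0)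
          (𝓝 (ell lam : EReal)) ∧
        Tendsto (fun ε : ℝ => upperRate lam q (fun n => smallComponents n (ε * n))) (𝓝[>] 0)
          (𝓝 (ell lam : EReal))) ∧
      (∀ K : Set ℝ, IsCompact K → K ⊆ Set.Ioi 0 \ {q} →
        TendstoUniformlyOn (fun (n : ℕ) (lam : ℝ) => logRate lam q n (acyclicGraphs n))
          ell atTop K ∧
        ERealTendstoUniformlyOn
          (fun (r : ℝ) (lam : ℝ) => lowerRate lam q (fun n => smallComponents n r))
          ell atTop K ∧
        ERealTendstoUniformlyOn
          (fun (r : ℝ) (lam : ℝ) => upperRate lam q (fun n => smallComponents n r))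
          ell atTop K ∧
        ERealTendstoUniformlyOn
          (fun (ε : ℝ) (lam : ℝ) => lowerRate lam q (fun n => smallComponents n (ε * n)))
          ell (𝓝[>] 0) K ∧
        ERealTendstoUniformlyOn
          (fun (ε : ℝ) (lam : ℝ) => upperRate lam q (fun n => smallComponents n (ε * n)))
          ell (𝓝[>] 0) K ∧
        (∀ δ : ℝ, 0 < δ → ∀ᶠ r : ℝ in atTop, ∀ᶠ n : ℕ in atTop, ∀ lam ∈ K,
          |logRate lam q n (smallComponents n r) - ell lam| < δ) ∧
        (∀ δ : ℝ, 0 < δ → ∀ᶠ ε : ℝ in 𝓝[>] 0, ∀ᶠ n : ℕ in atTop, ∀ lam ∈ K,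
          |logRate lam q n (smallComponents n (ε * n)) - ell lam| < δ)) := by
  have hunif : ∀ K : Set ℝ, IsCompact K → K ⊆ Set.Ioi 0 →
      TendstoUniformlyOn (fun (n : ℕ) (lam : ℝ) => logRate lam q n (acyclicGraphs n))
        (acyclicRate q) atTop K := by
    intro K hK hK0
    refine Metric.tendstoUniformlyOn_iff.2 fun δ hδ => ?_
    obtain ⟨r, _, h⟩ := logRate_uniform hq hK hK0 hδ
    filter_upwards [h] with n hn lam hlam
    rw [dist_comm, Real.dist_eq]
    exact (hn lam hlam).1
  refine ⟨acyclicRate q, fun lam hlam => ?_, fun K hK hKs => ?_⟩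
  -- The pointwise limits are the uniform ones on a one-point compact set.
  · have hK0 : ({lam} : Set ℝ) ⊆ Set.Ioi 0 := Set.singleton_subset_iff.2 hlam
    obtain ⟨h1, h2⟩ := ERealTendstoUniformlyOn.liminf_limsup fun δ hδ =>
      logRate_smallComponents_uniform hq isCompact_singleton hK0 (δ := δ) hδ
    obtain ⟨h3, h4⟩ := ERealTendstoUniformlyOn.liminf_limsup fun δ hδ =>
      logRate_smallComponents_mul_uniform hq isCompact_singleton hK0 (δ := δ) hδ
    have hmem := Set.mem_singleton lam
    exact ⟨(hunif _ isCompact_singleton hK0).tendsto_at hmem, h1.tendsto hmem, h2.tendsto hmem,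
      h3.tendsto hmem, h4.tendsto hmem⟩
  · have hK0 : K ⊆ Set.Ioi 0 := hKs.trans Set.sdiff_subset
    have hr := fun δ hδ => logRate_smallComponents_uniform hq hK hK0 (δ := δ) hδ
    have hε := fun δ hδ => logRate_smallComponents_mul_uniform hq hK hK0 (δ := δ) hδ
    obtain ⟨h1, h2⟩ := ERealTendstoUniformlyOn.liminf_limsup hr
    obtain ⟨h3, h4⟩ := ERealTendstoUniformlyOn.liminf_limsup hε
    exact ⟨hunif K hK hK0, h1, h2, h3, h4, hr, hε⟩
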